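/- Let $M$ be a smooth (finite-dimensional, Hausdorff, second countable) manifold and let $\star=\sum_{r\ge 0}\lambda^r C_r$ be a star product on $M$: an associative $\mathbb{C}[[\lambda]]$-bilinear product on $C^\infty(M)[[\lambda]]$ (complex-valued functions) with $C_0(f,g)=fg$, with unit $1$, and with all $C_r$ bidifferential operators. Put $\boldsymbol{\mathcal A}=(C^\infty(M)[[\lambda]],\star)$ and let $\{f,g\}=\frac1{\mathrm i}(C_1(f,g)-C_1(g,f))$ be the Poisson bracket of $\star$. For invertible $u\in\boldsymbol{\mathcal A}$ let $\mathrm{Ad}(u)(f)=u\star f\star u^{-1}$, and for $H\in\boldsymbol{\mathcal A}$ let $\mathrm{ad}(H)(f)=H\star f-f\star H$. Let $\mathrm{Der}(\boldsymbol{\mathcal A})$ be the $\mathbb{C}[[\lambda]]$-linear derivations of $\star$ and $\mathrm{InnDer}(\boldsymbol{\mathcal A})=\{\mathrm{ad}(H): H\in\boldsymbol{\mathcal A}\}$. Exponentials of operators are $\lambda$-adically convergent series. Suppose that $\star$ satisfies C0) there is a $\mathbb{C}$-linear map $\rho_0$ from the Poisson centre $\{f\in C^\infty(M): \{f,g\}=0\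 \forall g\in C^\infty(M)\}$ to the centre of $\boldsymbol{\mathcal A}$ with $\rho_0(f)=f+O(\lambda)$. Then: (1) If $T=\mathrm{Ad}(u)$ is an inner automorphism of $\boldsymbol{\mathcal A}$ with $T=\mathrm{id}+O(\lambda^2)$, then there exist an invertible $u'=1+O(\lambda)$ in $\boldsymbol{\mathcal A}$ and a global function $H\in\lambda C^\infty(M)[[\lambda]]$ such that $T=\mathrm{Ad}(u')=e^{\mathrm{ad}(H)}$. (2) Let $G$ be the group of $\mathbb{C}[[\lambda]]$-algebra automorphisms $T=\mathrm{id}+O(\lambda^2)$ of $\boldsymbol{\mathcal A}$, that is, of the self-equivalences $T=\mathrm{id}+\lambda T_1+\lambda^2T_2+\cdots$ with $T_1=0$, and let $N=\{\mathrm{Ad}(u): u=1+O(\lambda)\}$. Then $N$ is a normal subgroup of $G$, $\mathrm{InnDer}(\boldsymbol{\mathcal A})\subseteq\lambda\,\mathrm{Der}(\boldsymbol{\mathcal A})$, every $T\in G$ can be written as $T=e^{\lambda D}$ for a unique $D\in\lambda\,\mathrm{Der}(\boldsymbol{\mathcal A})$, and $T=e^{\lambda D}\mapsto D$ induces a well-defined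 bijection $$G/N\;\longrightarrow\;\lambda\,\mathrm{Der}(\boldsymbol{\mathcal A})/\mathrm{InnDer}(\boldsymbol{\mathcal A}).$$ -/

import Mathlib

open scoped ContDiff Manifold PowerSeries

noncomputable section

/-- The algebra `C^∞(M)` of smooth complex-valued functions on a manifold `M` modelled on the
real vector space `E`. -/
def SmoothFun (E : Type*) [NormedAddCommGroup E] [NormedSpace ℝ E]
    (M : Type*) [TopologicalSpace M] [ChartedSpace E M] : Subalgebra ℂ (M → ℂ) where
  carrier := {f | ContMDiff 𝓘(ℝ, E) 𝓘(ℝ, ℂ) ∞ f}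
  mul_mem' hf hg := (contDiff_mul (𝕜 := ℝ) (𝔸 := ℂ)).contMDiff.comp (ContMDiff.prodMk_space hf hg)
  add_mem' hf hg := ContMDiff.add hf hg
  algebraMap_mem' _ := contMDiff_const

/-- `x = y + O(λ^n)` in a module over `ℂ[[λ]]`; here `λ` is `PowerSeries.X`. -/
def EqUpTo {V : Type*} [AddCommGroup V] [Module ℂ⟦X⟧ V] (n : ℕ) (x y : V) : Prop :=
  ∃ z : V, x = y + (PowerSeries.X : ℂ⟦X⟧) ^ n • z

/-- `T = e^E`: for every `f` the partial sums of `∑ E^k f / k!` converge to `T f` in the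
`λ`-adic topology. -/
def IsFormalExp {V : Type*} [AddCommGroup V] [Module ℂ⟦X⟧ V]
    (E T : Module.End ℂ⟦X⟧ V) : Prop :=
  ∀ (f : V) (n : ℕ), ∃ N : ℕ, ∀ m ≥ N,
    EqUpTo n (T f)
      (∑ k ∈ Finset.range m, PowerSeries.C ((k.factorial : ℂ)⁻¹) • (E ^ k) f)

/-- Linear differential operators of order at most `k` on a commutative algebra: the iterated
commutators with `k + 1` multiplication operators vanish. On `C^∞(M)` these are the usual
linear differential operators with smooth coefficients. -/
def IsDiffOp {A : Type*} [CommRing A] [Algebra ℂ A] : ℕ → (A →ₗ[ℂ] A) → Prop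
  | 0, D => ∀ f : A, D ∘ₗ LinearMap.mulLeft ℂ f - LinearMap.mulLeft ℂ f ∘ₗ D = 0
  | k + 1, D => ∀ f : A, IsDiffOp k (D ∘ₗ LinearMap.mulLeft ℂ f - LinearMap.mulLeft ℂ f ∘ₗ D)

/-- Bidifferential operators: bilinear maps that are differential operators, of bounded order,
in each of the two arguments. -/
def IsBidiffOp {A : Type*} [CommRing A] [Algebra ℂ A] (B : A →ₗ[ℂ] A →ₗ[ℂ] A) : Prop :=
  ∃ k : ℕ, ∀ f : A, IsDiffOp k (B f) ∧ IsDiffOp k (B.flip f)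

/-- A formal deformation of a commutative unital algebra `A`: an associative
`ℂ[[λ]]`-bilinear product on `A[[λ]]` with `a ⋆ b = ∑ λ^r C_r(a, b)` for `a, b ∈ A`, where the
`C_r` are bilinear, `C_0(a, b) = a b`, and `1` is a unit for `⋆`. -/
structure FormalDeformation (A : Type*) [CommRing A] [Algebra ℂ A] where
  star : A⟦X⟧ →ₗ[ℂ⟦X⟧] A⟦X⟧ →ₗ[ℂ⟦X⟧] A⟦X⟧
  cochain : ℕ → A →ₗ[ℂ] A →ₗ[ℂ] A
  star_C : ∀ a b : A,
    star (PowerSeries.C a) (PowerSeries.C b) = PowerSeries.mk fun r => cochain r a b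
  cochain_zero : ∀ a b : A, cochain 0 a b = a * b
  star_assoc : ∀ a b c : A⟦X⟧, star (star a b) c = star a (star b c)
  one_star : ∀ a : A⟦X⟧, star 1 a = a
  star_one : ∀ a : A⟦X⟧, star a 1 = a

namespace FormalDeformation

variable {A : Type*} [CommRing A] [Algebra ℂ A]

/-- The deformed algebra `(A[[λ]], ⋆)`. -/
def Alg (_S : FormalDeformation A) : Type _ := A⟦X⟧

variable (S : FormalDeformation A)

instance : AddCommGroup S.Alg := inferInstanceAs (AddCommGroup A⟦X⟧)

instance : Module ℂ⟦X⟧ S.Alg := inferInstanceAs (Module ℂ⟦X⟧ A⟦X⟧)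

instance : Module ℂ S.Alg := inferInstanceAs (Module ℂ A⟦X⟧)

instance : Ring S.Alg where
  __ := (inferInstance : AddCommGroup S.Alg)
  mul a b := S.star a b
  one := (1 : A⟦X⟧)
  mul_assoc := S.star_assoc
  one_mul := S.one_star
  mul_one := S.star_one
  left_distrib a b c := (S.star a).map_add b c
  right_distrib a b c := LinearMap.map_add₂ S.star a b c
  zero_mul a := LinearMap.map_zero₂ S.star a
  mul_zero a := (S.star a).map_zero

instance : Algebra ℂ⟦X⟧ S.Alg :=
  Algebra.ofModule
    (fun r x y => LinearMap.map_smul₂ S.star r x y)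
    (fun r x y => (S.star x).map_smul r y)

/-- The inclusion `A → A[[λ]]` as constant series. -/
def const (a : A) : S.Alg := (PowerSeries.C a : A⟦X⟧)

/-- The automorphism group of the `ℂ[[λ]]`-algebra `(A[[λ]], ⋆)`. -/
abbrev Aut : Type _ := S.Alg ≃ₐ[ℂ⟦X⟧] S.Alg

/-- `Ad(u) : a ↦ u ⋆ a ⋆ u⁻¹`. -/
def Ad : S.Algˣ →* S.Aut where
  toFun u := AlgEquiv.ofAlgHom
    { toFun := fun a => (u : S.Alg) * a * ((u⁻¹ : S.Algˣ) : S.Alg)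
      map_one' := by simp
      map_mul' := fun a b => by simp [mul_assoc]
      map_zero' := by simp
      map_add' := fun a b => by simp [mul_add, add_mul]
      commutes' := fun r => by rw [← Algebra.commutes, mul_assoc, Units.mul_inv, mul_one] }
    { toFun := fun a => ((u⁻¹ : S.Algˣ) : S.Alg) * a * (u : S.Alg)
      map_one' := by simp
      map_mul' := fun a b => by simp [mul_assoc]
      map_zero' := by simp
      map_add' := fun a b => by simp [mul_add, add_mul]
      commutes' := fun r => by rw [← Algebra.commutes, mul_assoc, Units.inv_mul, mul_one] }
    (by ext a; simp [mul_assoc])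
    (by ext a; simp [mul_assoc])
  map_one' := by ext a; simp
  map_mul' u v := by ext a; simp [mul_assoc]

/-- `ad(H) : a ↦ H ⋆ a - a ⋆ H`. -/
def ad : S.Alg →ₗ[ℂ⟦X⟧] Module.End ℂ⟦X⟧ S.Alg :=
  LinearMap.mul ℂ⟦X⟧ S.Alg - (LinearMap.mul ℂ⟦X⟧ S.Alg).flip

/-- The `ℂ[[λ]]`-linear derivations of `⋆`. -/
def Der : Submodule ℂ⟦X⟧ (Module.End ℂ⟦X⟧ S.Alg) where
  carrier := {D | ∀ a b : S.Alg, D (a * b) = D a * b + a * D b}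
  add_mem' {D D'} hD hD' a b := by
    simp only [LinearMap.add_apply, hD a b, hD' a b, add_mul, mul_add]
    abel
  zero_mem' a b := by simp
  smul_mem' r D hD a b := by simp [hD a b, smul_add]

/-- The derivations of the form `λ D` with `D` a derivation. -/
def lambdaDer : Submodule ℂ⟦X⟧ (Module.End ℂ⟦X⟧ S.Alg) :=
  S.Der.map (LinearMap.lsmul ℂ⟦X⟧ (Module.End ℂ⟦X⟧ S.Alg) PowerSeries.X)

/-- The inner derivations `ad(H)`. -/
def InnDer : Submodule ℂ⟦X⟧ (Module.End ℂ⟦X⟧ S.Alg) := LinearMap.range S.ad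

/-- The automorphisms `T = id + O(λ^n)`. For `n = 1` these are the self-equivalences
`T = id + λ T_1 + λ² T_2 + ⋯`, for `n = 2` the self-equivalences with `T_1 = 0`. -/
def selfEquiv (n : ℕ) : Subgroup S.Aut where
  carrier := {T | EqUpTo n T.toLinearMap LinearMap.id}
  mul_mem' {T T'} := by
    rintro ⟨Z, hZ⟩ ⟨Z', hZ'⟩
    refine ⟨Z + Z' + (PowerSeries.X : ℂ⟦X⟧) ^ n • (Z ∘ₗ Z'), ?_⟩
    ext f
    have h1 := fun g => LinearMap.congr_fun hZ g
    have h2 := LinearMap.congr_fun hZ' f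
    simp only [AlgEquiv.toLinearMap_apply, LinearMap.add_apply, LinearMap.id_apply,
      LinearMap.smul_apply, AlgEquiv.mul_apply, LinearMap.comp_apply] at h1 h2 ⊢
    rw [h2, h1, map_add, map_smul]
    simp only [smul_add]
    abel
  one_mem' := ⟨0, by ext f; simp⟩
  inv_mem' {T} := by
    rintro ⟨Z, hZ⟩
    refine ⟨-(T⁻¹ : S.Aut).toLinearMap ∘ₗ Z, ?_⟩
    ext f
    have h1 := congrArg (fun g => (T⁻¹ : S.Aut) g) (LinearMap.congr_fun hZ f)
    simp only [AlgEquiv.toLinearMap_apply, LinearMap.add_apply, LinearMap.id_apply,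
      LinearMap.smul_apply, map_add, map_smul, LinearMap.comp_apply, LinearMap.neg_apply,
      smul_neg] at h1 ⊢
    have h2 : (T⁻¹ : S.Aut) (T f) = f := T.symm_apply_apply f
    rw [h2] at h1
    rw [← sub_eq_add_neg]
    exact eq_sub_of_add_eq h1.symm

/-- The invertible elements `u = 1 + O(λ)`. -/
def unitsOne : Subgroup S.Algˣ where
  carrier := {u | EqUpTo 1 (u : S.Alg) 1}
  mul_mem' {u v} := by
    rintro ⟨z, hz⟩ ⟨w, hw⟩
    refine ⟨w + z * v, ?_⟩
    rw [Units.val_mul, hz, add_mul, one_mul, smul_mul_assoc]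
    nth_rewrite 1 [hw]
    rw [smul_add, add_assoc]
  one_mem' := ⟨0, by simp⟩
  inv_mem' {u} := by
    rintro ⟨z, hz⟩
    refine ⟨-(((u⁻¹ : S.Algˣ) : S.Alg) * z), ?_⟩
    have h := congrArg (fun x => ((u⁻¹ : S.Algˣ) : S.Alg) * x) hz
    simp only [Units.inv_mul, mul_add, mul_one, mul_smul_comm] at h
    rw [smul_neg, h]
    simp

/-- The inner automorphisms `Ad(u)` with `u = 1 + O(λ)`. -/
def innerOne : Subgroup S.Aut := S.unitsOne.map S.Ad

/-- The Poisson bracket `{f, g} = (C_1(f, g) - C_1(g, f)) / i` of the deformation. -/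
def poissonBracket (f g : A) : A :=
  (Complex.I)⁻¹ • (S.cochain 1 f g - S.cochain 1 g f)

/-- The centre of the Poisson algebra `(A, { , })`. -/
def poissonCenter : Submodule ℂ A where
  carrier := {f | ∀ g : A, S.poissonBracket f g = 0}
  add_mem' {f f'} hf hf' g := by
    have h : S.poissonBracket (f + f') g = S.poissonBracket f g + S.poissonBracket f' g := by
      simp only [poissonBracket, map_add, LinearMap.add_apply, ← smul_add]
      congr 1
      abel
    rw [h, hf g, hf' g, add_zero]
  zero_mem' g := by simp [poissonBracket]
  smul_mem' c f hf g := by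
    have h : S.poissonBracket (c • f) g = c • S.poissonBracket f g := by
      simp only [poissonBracket, map_smul, LinearMap.smul_apply, ← smul_sub]
      exact smul_comm _ _ _
    rw [h, hf g, smul_zero]

/-- Condition C0: there is a linear map `ρ₀` from the Poisson centre of `A` to the centre of
`(A[[λ]], ⋆)` with `ρ₀(f) = f + O(λ)`. -/
def ConditionC0 : Prop :=
  ∃ ρ : S.poissonCenter →ₗ[ℂ] S.Alg, ∀ f : S.poissonCenter,
    ρ f ∈ Subalgebra.center ℂ⟦X⟧ S.Alg ∧ EqUpTo 1 (ρ f) (S.const (f : A))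

end FormalDeformation

/-- A star product on `M`: a formal deformation of `C^∞(M)` by bidifferential operators. -/
structure StarProduct (E : Type*) [NormedAddCommGroup E] [NormedSpace ℝ E]
    (M : Type*) [TopologicalSpace M] [ChartedSpace E M] extends
    FormalDeformation (SmoothFun E M) where
  bidiff : ∀ r : ℕ, IsBidiffOp (cochain r)

end

-- `A⟦λ⟧` and its spaces of operators are `λ`-torsion-free and `λ`-adically complete, so operators
-- `id + O(λ)` correspond bijectively to exponents `O(λ)`. If `e^E` is an automorphism, conjugation
-- by it sends left multiplication by `a` to left multiplication by `e^E a`; comparing exponents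
-- gives `[E, L_a] = L_{E a}`, so `E` is a derivation.
--
-- The core is `e^{D + ad K} = Ad(u) e^D` with `u = e^{D + L_K}(1)`. Every `u = 1 + O(λ)` arises
-- from some `K = O(λ)`, so two automorphisms differ by `Ad(u)` with such a `u` exactly when their
-- exponents differ by some `ad(λH) = λ ad(H)`. Dividing by `λ` matches the cosets of `N` with those
-- of the inner derivations, and no Baker–Campbell–Hausdorff formula is needed. The case `D = 0`
-- writes `Ad(u)` as `e^{ad H}`.
--
-- C0 serves to normalise `u` in (1): if `Ad(u) = id + O(λ²)`, then `u₀` is Poisson central, and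
-- dividing `u` by the central element `ρ₀(u₀)` gives `1 + O(λ)` without changing `Ad(u)`.

local notation "ϖ" => (PowerSeries.X : ℂ⟦X⟧)

noncomputable section

/-! ### Calculus of congruences modulo `λ^n`. -/

namespace EqUpTo

variable {V W : Type*} [AddCommGroup V] [Module ℂ⟦X⟧ V] [AddCommGroup W] [Module ℂ⟦X⟧ W]
variable {n m : ℕ} {x y z x' y' : V}

theorem refl (n : ℕ) (x : V) : EqUpTo n x x := ⟨0, by simp⟩

theorem zero (x y : V) : EqUpTo 0 x y := ⟨x - y, by simp⟩

theorem symm (h : EqUpTo n x y) : EqUpTo n y x := by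
  obtain ⟨z, rfl⟩ := h
  exact ⟨-z, by simp⟩

theorem trans (h : EqUpTo n x y) (h' : EqUpTo n y z) : EqUpTo n x z := by
  obtain ⟨a, rfl⟩ := h
  obtain ⟨b, rfl⟩ := h'
  exact ⟨b + a, by rw [smul_add, add_assoc]⟩

theorem add (h : EqUpTo n x y) (h' : EqUpTo n x' y') : EqUpTo n (x + x') (y + y') := by
  obtain ⟨a, rfl⟩ := h
  obtain ⟨b, rfl⟩ := h'
  exact ⟨a + b, by rw [smul_add]; abel⟩

theorem sub (h : EqUpTo n x y) (h' : EqUpTo n x' y') : EqUpTo n (x - x') (y - y') := by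
  obtain ⟨a, rfl⟩ := h
  obtain ⟨b, rfl⟩ := h'
  exact ⟨a - b, by rw [smul_sub]; abel⟩

theorem map (h : EqUpTo n x y) (f : V →ₗ[ℂ⟦X⟧] W) : EqUpTo n (f x) (f y) := by
  obtain ⟨a, rfl⟩ := h
  exact ⟨f a, by simp⟩

theorem smul (h : EqUpTo n x y) (c : ℂ⟦X⟧) : EqUpTo n (c • x) (c • y) := by
  simpa using h.map (LinearMap.lsmul ℂ⟦X⟧ V c)

theorem X_smul (h : EqUpTo n x y) : EqUpTo (n + 1) (ϖ • x) (ϖ • y) := by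
  obtain ⟨a, rfl⟩ := h
  exact ⟨a, by rw [smul_add, smul_smul, pow_succ']⟩

theorem mono (h : EqUpTo n x y) (hm : m ≤ n) : EqUpTo m x y := by
  obtain ⟨a, rfl⟩ := h
  obtain ⟨k, rfl⟩ := Nat.exists_eq_add_of_le hm
  exact ⟨ϖ ^ k • a, by rw [smul_smul, pow_add]⟩

theorem sub_zero_iff : EqUpTo n (x - y) 0 ↔ EqUpTo n x y := by
  constructor
  · rintro ⟨z, hz⟩
    exact ⟨z, by rw [zero_add] at hz; rw [← hz]; abel⟩
  · rintro ⟨z, rfl⟩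
    exact ⟨z, by simp⟩

theorem sum {ι : Type*} {s : Finset ι} {f g : ι → V} (h : ∀ i ∈ s, EqUpTo n (f i) (g i)) :
    EqUpTo n (∑ i ∈ s, f i) (∑ i ∈ s, g i) := by
  classical
  induction s using Finset.induction_on with
  | empty => exact refl _ _
  | insert a s ha ih =>
    rw [Finset.sum_insert ha, Finset.sum_insert ha]
    exact (h a (by simp)).add (ih fun i hi => h i (by simp [hi]))

theorem sum_range {f : ℕ → V} {a b : ℕ} (hab : a ≤ b) (h : ∀ k, a ≤ k → EqUpTo n (f k) 0) :
    EqUpTo n (∑ k ∈ Finset.range b, f k) (∑ k ∈ Finset.range a, f k) := by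
  induction b, hab using Nat.le_induction with
  | base => exact refl _ _
  | succ b hb ih =>
    rw [Finset.sum_range_succ]
    simpa using ih.add (h b hb)

theorem zero_iff : EqUpTo n x 0 ↔ ∃ z, x = ϖ ^ n • z := by simp [EqUpTo]

theorem one_zero_iff : EqUpTo 1 x 0 ↔ ∃ z, x = ϖ • z := by simp [EqUpTo]

theorem apply_apply {E : V →ₗ[ℂ⟦X⟧] W} (hE : EqUpTo m E 0) (h : EqUpTo n x y) :
    EqUpTo (n + m) (E x) (E y) := by
  obtain ⟨F, rfl⟩ := zero_iff.1 hE
  obtain ⟨a, rfl⟩ := h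
  exact ⟨F a, by simp [pow_add, smul_smul, mul_comm]⟩

theorem linearMap_apply {E F : V →ₗ[ℂ⟦X⟧] W} (h : EqUpTo n E F) (v : V) :
    EqUpTo n (E v) (F v) := by
  obtain ⟨G, rfl⟩ := h
  exact ⟨G v, by simp⟩

theorem pow_apply {E : Module.End ℂ⟦X⟧ V} (hE : EqUpTo 1 E 0) (k : ℕ) (v : V) :
    EqUpTo k ((E ^ k) v) 0 := by
  induction k with
  | zero => exact zero _ _
  | succ k ih =>
    rw [pow_succ', Module.End.mul_apply]
    simpa using apply_apply hE ih

end EqUpTo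

/-- Modules over `ℂ⟦λ⟧` without `λ`-torsion that are Hausdorff and complete in the
`λ`-adic topology. -/
class LambdaComplete (V : Type*) [AddCommGroup V] [Module ℂ⟦X⟧ V] : Prop where
  torsion_free : ∀ x : V, ϖ • x = 0 → x = 0
  hausdorff : ∀ x : V, (∀ n, EqUpTo n x 0) → x = 0
  complete : ∀ x : ℕ → V, (∀ n, EqUpTo n (x (n + 1)) (x n)) → ∃ l, ∀ n, EqUpTo n l (x n)

/-! ### Completeness of operator spaces, fixed points and invertibility. -/

namespace LambdaComplete

variable {V W : Type*} [AddCommGroup V] [Module ℂ⟦X⟧ V] [AddCommGroup W] [Module ℂ⟦X⟧ W]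
variable [LambdaComplete V]

theorem X_smul_cancel {x y : V} (h : ϖ • x = ϖ • y) : x = y :=
  sub_eq_zero.1 (torsion_free _ (by rw [smul_sub, h, sub_self]))

theorem X_pow_smul_cancel {n : ℕ} {x y : V} (h : ϖ ^ n • x = ϖ ^ n • y) : x = y := by
  induction n with
  | zero => simpa using h
  | succ n ih =>
    refine ih (X_smul_cancel ?_)
    rwa [smul_smul, smul_smul, ← pow_succ']

theorem eqUpTo_of_X_smul {n : ℕ} {x y : V} (h : EqUpTo (n + 1) (ϖ • x) (ϖ • y)) :
    EqUpTo n x y := by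
  obtain ⟨z, hz⟩ := h
  exact ⟨z, X_smul_cancel (by rw [hz, smul_add, smul_smul, pow_succ'])⟩

theorem eq_of_eqUpTo {x y : V} (h : ∀ n, EqUpTo n x y) : x = y :=
  sub_eq_zero.1 (hausdorff _ fun n => EqUpTo.sub_zero_iff.2 (h n))

/-- Without torsion the quotient by `λ^n` is unique at each point, so the chosen quotients
automatically form a linear map. -/
theorem eqUpTo_linearMap {n : ℕ} {f g : W →ₗ[ℂ⟦X⟧] V} (h : ∀ w, EqUpTo n (f w) (g w)) :
    EqUpTo n f g := by
  choose z hz using h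
  refine ⟨{ toFun := z, map_add' := fun a b => ?_, map_smul' := fun c a => ?_ }, ?_⟩
  · apply X_pow_smul_cancel (n := n)
    have := hz (a + b)
    rw [map_add, map_add, hz a, hz b] at this
    rw [smul_add]
    have h2 := congrArg (fun t => t - (g a + g b)) this
    simp only [add_sub_cancel_left] at h2
    rw [← h2]
    abel
  · apply X_pow_smul_cancel (n := n)
    have := hz (c • a)
    rw [map_smul, map_smul, hz a, smul_add] at this
    rw [← add_left_cancel this, RingHom.id_apply, smul_comm]
  · ext w
    simpa using hz w

/-- This lets exponentials and fixed-point arguments be applied to operators, and to operators on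
operators. -/
instance : LambdaComplete (W →ₗ[ℂ⟦X⟧] V) where
  torsion_free f h := by
    ext w
    exact torsion_free _ (LinearMap.congr_fun h w)
  hausdorff f h := by
    ext w
    exact hausdorff _ fun n => (h n).linearMap_apply w
  complete f h := by
    choose l hl using fun w => complete (fun n => f n w) fun n => (h n).linearMap_apply w
    refine ⟨{ toFun := l, map_add' := fun a b => ?_, map_smul' := fun c a => ?_ },
      fun n => eqUpTo_linearMap fun w => hl w n⟩
    · refine eq_of_eqUpTo fun n => (hl (a + b) n).trans ?_
      simpa using ((hl a n).add (hl b n)).symm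
    · refine eq_of_eqUpTo fun n => (hl (c • a) n).trans ?_
      simpa using ((hl a n).smul c).symm

/-- A `λ`-adic contraction has a fixed point. -/
theorem exists_fixedPoint (F : V → V) (x₀ : V) (h₀ : ∀ x, EqUpTo 1 x x₀ → EqUpTo 1 (F x) x₀)
    (hF : ∀ n x y, EqUpTo 1 x x₀ → EqUpTo 1 y x₀ → EqUpTo n x y → EqUpTo (n + 1) (F x) (F y)) :
    ∃ x, EqUpTo 1 x x₀ ∧ F x = x := by
  let s : ℕ → V := fun n => F^[n] x₀
  have hs (n : ℕ) : s (n + 1) = F (s n) := Function.iterate_succ_apply' F n x₀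
  have hs₀ (n : ℕ) : EqUpTo 1 (s n) x₀ := by
    induction n with
    | zero => exact EqUpTo.refl _ _
    | succ n ih => rw [hs]; exact h₀ _ ih
  have hc (n : ℕ) : EqUpTo n (s (n + 1)) (s n) := by
    induction n with
    | zero => exact EqUpTo.zero _ _
    | succ n ih =>
      have h := hF n _ _ (hs₀ (n + 1)) (hs₀ n) ih
      rwa [← hs, ← hs] at h
  obtain ⟨l, hl⟩ := complete s hc
  have hl₀ : EqUpTo 1 l x₀ := (hl 1).trans (hs₀ 1)
  refine ⟨l, hl₀, eq_of_eqUpTo fun n => ?_⟩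
  refine (((hF n _ _ hl₀ (hs₀ n) (hl n)).mono n.le_succ).trans ?_).trans (hl n).symm
  rw [← hs]
  exact hc n

/-- For `T = id + λZ`, a kernel element satisfies `x = -λ Z x`, so it is divisible by every `λ^n`; a
preimage of `y` is a fixed point of `x ↦ y - λ Z x`. -/
theorem bijective_of_eqUpTo_one {T : Module.End ℂ⟦X⟧ V} (hT : EqUpTo 1 T LinearMap.id) :
    Function.Bijective T := by
  obtain ⟨Z, rfl⟩ := hT
  constructor
  · rw [injective_iff_map_eq_zero]
    intro x hx
    have hx' : x = ϖ • Z (-x) := by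
      have : x + ϖ • Z x = 0 := by simpa using hx
      rw [map_neg, smul_neg]
      exact eq_neg_of_add_eq_zero_left this
    refine hausdorff _ fun n => ?_
    induction n with
    | zero => exact EqUpTo.zero _ _
    | succ n ih =>
      rw [hx']
      have h := (((EqUpTo.refl n (0 : V)).sub ih).map Z).X_smul
      simpa using h
  · intro y
    obtain ⟨x, -, hx⟩ := exists_fixedPoint (fun x => y - ϖ • Z x) y
      (fun x _ => ⟨-Z x, by simp [sub_eq_add_neg]⟩)
      (fun n x x' _ _ h => (EqUpTo.refl _ y).sub (h.map Z).X_smul)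
    exact ⟨x, by simpa using (sub_eq_iff_eq_add.1 hx).symm⟩

theorem isUnit_of_eqUpTo_one {B : Type*} [Ring B] [Algebra ℂ⟦X⟧ B] [LambdaComplete B] {b : B}
    (hb : EqUpTo 1 b 1) : IsUnit b := by
  have hl : EqUpTo 1 (LinearMap.mulLeft ℂ⟦X⟧ b) LinearMap.id := by
    obtain ⟨z, rfl⟩ := hb
    exact ⟨LinearMap.mulLeft ℂ⟦X⟧ z, by ext; simp [add_mul]⟩
  have hr : EqUpTo 1 (LinearMap.mulRight ℂ⟦X⟧ b) LinearMap.id := by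
    obtain ⟨z, rfl⟩ := hb
    exact ⟨LinearMap.mulRight ℂ⟦X⟧ z, by ext; simp [mul_add]⟩
  obtain ⟨c, hc⟩ := (bijective_of_eqUpTo_one hl).2 1
  obtain ⟨d, hd⟩ := (bijective_of_eqUpTo_one hr).2 1
  simp only [LinearMap.mulLeft_apply, LinearMap.mulRight_apply] at hc hd
  have hdc : d = c := left_inv_eq_right_inv hd hc
  exact ⟨⟨b, c, hc, hdc ▸ hd⟩, rfl⟩

end LambdaComplete

/-! ### Formal exponentials and logarithms of operators. -/

section FormalExp

variable {U V W : Type*} [AddCommGroup U] [Module ℂ⟦X⟧ U] [AddCommGroup V] [Module ℂ⟦X⟧ V]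
  [AddCommGroup W] [Module ℂ⟦X⟧ W]

/-- The partial sums of the exponential series. -/
def expSum (E : Module.End ℂ⟦X⟧ V) (n : ℕ) : Module.End ℂ⟦X⟧ V :=
  ∑ k ∈ Finset.range n, PowerSeries.C ((k.factorial : ℂ)⁻¹) • E ^ k

theorem expSum_apply (E : Module.End ℂ⟦X⟧ V) (n : ℕ) (v : V) :
    expSum E n v = ∑ k ∈ Finset.range n, PowerSeries.C ((k.factorial : ℂ)⁻¹) • (E ^ k) v := by
  simp [expSum, LinearMap.sum_apply]

theorem expTerm_eqUpTo {E : Module.End ℂ⟦X⟧ V} (hE : EqUpTo 1 E 0) (k : ℕ) (v : V) :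
    EqUpTo k (PowerSeries.C ((k.factorial : ℂ)⁻¹) • (E ^ k) v) 0 := by
  simpa using (EqUpTo.pow_apply hE k v).smul (PowerSeries.C ((k.factorial : ℂ)⁻¹))

theorem expSum_eqUpTo {E : Module.End ℂ⟦X⟧ V} (hE : EqUpTo 1 E 0) {n m : ℕ} (h : n ≤ m) (v : V) :
    EqUpTo n (expSum E m v) (expSum E n v) := by
  rw [expSum_apply, expSum_apply]
  exact EqUpTo.sum_range h fun k hk => (expTerm_eqUpTo hE k v).mono hk

theorem isFormalExp_iff {E T : Module.End ℂ⟦X⟧ V} (hE : EqUpTo 1 E 0) :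
    IsFormalExp E T ↔ ∀ n v, EqUpTo n (T v) (expSum E n v) := by
  constructor
  · intro h n v
    obtain ⟨N, hN⟩ := h v n
    have h1 := hN (max n N) (le_max_right _ _)
    rw [← expSum_apply] at h1
    exact h1.trans (expSum_eqUpTo hE (le_max_left _ _) v)
  · intro h v n
    refine ⟨n, fun m hm => ?_⟩
    rw [← expSum_apply]
    exact (h n v).trans (expSum_eqUpTo hE hm v).symm

theorem IsFormalExp.unique [LambdaComplete V] {E T T' : Module.End ℂ⟦X⟧ V} (hE : EqUpTo 1 E 0)
    (h : IsFormalExp E T) (h' : IsFormalExp E T') : T = T' := by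
  rw [isFormalExp_iff hE] at h h'
  ext v
  exact LambdaComplete.eq_of_eqUpTo fun n => (h n v).trans (h' n v).symm

theorem exists_isFormalExp [LambdaComplete V] {E : Module.End ℂ⟦X⟧ V} (hE : EqUpTo 1 E 0) :
    ∃ T, IsFormalExp E T := by
  obtain ⟨T, hT⟩ := LambdaComplete.complete (expSum E) fun n =>
    LambdaComplete.eqUpTo_linearMap fun v => expSum_eqUpTo hE n.le_succ v
  exact ⟨T, (isFormalExp_iff hE).2 fun n v => (hT n).linearMap_apply v⟩

/-- Two exponentials differ to leading order as their exponents do, relative to any map `j`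
that intertwines the exponents to that order. -/
theorem IsFormalExp.eqUpTo_sub {E S : Module.End ℂ⟦X⟧ V} {F T : Module.End ℂ⟦X⟧ W}
    (hE : EqUpTo 1 E 0) (hF : EqUpTo 1 F 0) (hS : IsFormalExp E S) (hT : IsFormalExp F T)
    (j : V →ₗ[ℂ⟦X⟧] W) {n : ℕ} (h : ∀ v, EqUpTo n (F (j v)) (j (E v))) (v : V) :
    EqUpTo (n + 1) (T (j v) - j (S v)) (F (j v) - j (E v)) := by
  have hpow (k : ℕ) (v : V) : EqUpTo n ((F ^ k) (j v)) (j ((E ^ k) v)) := by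
    induction k with
    | zero => exact EqUpTo.refl _ _
    | succ k ih =>
      rw [pow_succ', pow_succ', Module.End.mul_apply, Module.End.mul_apply]
      exact (ih.map F).trans (h _)
  -- From the second power on there is a spare factor `O(λ)`, which raises the congruence by one
  -- order. Hence only the linear term survives modulo `λ^(n+1)`.
  have hpow₂ (k : ℕ) (v : V) :
      EqUpTo (n + 1) ((F ^ (k + 2)) (j v)) (j ((E ^ (k + 2)) v)) := by
    rw [pow_succ', Module.End.mul_apply]
    refine (EqUpTo.apply_apply hF (hpow (k + 1) v)).trans ?_
    obtain ⟨G, rfl⟩ := EqUpTo.one_zero_iff.1 hE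
    have h1 := (h (G (((ϖ • G) ^ k) v))).X_smul
    rw [pow_succ' _ (k + 1), pow_succ' _ k, Module.End.mul_apply, Module.End.mul_apply]
    simpa using h1
  rw [isFormalExp_iff hE] at hS
  rw [isFormalExp_iff hF] at hT
  -- Using `n + 2` terms leaves the constant and linear ones to be split off whatever `n` is.
  have h1 := ((hT (n + 2) (j v)).sub ((hS (n + 2) v).map j)).mono (Nat.le_succ (n + 1))
  refine h1.trans ?_
  rw [expSum_apply, expSum_apply, map_sum, ← Finset.sum_sub_distrib, Finset.sum_range_succ',
    Finset.sum_range_succ']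
  have h2 : EqUpTo (n + 1) (∑ k ∈ Finset.range n,
      (PowerSeries.C (((k + 1 + 1).factorial : ℂ)⁻¹) • (F ^ (k + 1 + 1)) (j v) -
        j (PowerSeries.C (((k + 1 + 1).factorial : ℂ)⁻¹) • (E ^ (k + 1 + 1)) v))) 0 := by
    have := EqUpTo.sum (s := Finset.range n) (g := fun _ => (0 : W)) fun k _ =>
      EqUpTo.sub_zero_iff.2 ((hpow₂ k v).smul (PowerSeries.C (((k + 1 + 1).factorial : ℂ)⁻¹)))
    simpa using this
  have h3 := h2.add (EqUpTo.refl (n + 1) (F (j v) - j (E v)))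
  simpa using h3

/-- A map that intertwines two exponentials intertwines their exponents. -/
theorem IsFormalExp.intertwine [LambdaComplete W] {E S : Module.End ℂ⟦X⟧ V}
    {F T : Module.End ℂ⟦X⟧ W} (hE : EqUpTo 1 E 0) (hF : EqUpTo 1 F 0) (hS : IsFormalExp E S)
    (hT : IsFormalExp F T) (j : V →ₗ[ℂ⟦X⟧] W) (h : ∀ v, T (j v) = j (S v)) (v : V) :
    F (j v) = j (E v) := by
  refine LambdaComplete.eq_of_eqUpTo fun n => ?_
  induction n generalizing v with
  | zero => exact EqUpTo.zero _ _
  | succ n ih =>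
    -- The exponentials are intertwined exactly, so the leading difference of the exponents vanishes
    -- and agreement improves by one order.
    have h1 := hS.eqUpTo_sub hE hF hT j ih v
    rw [h, sub_self] at h1
    exact EqUpTo.sub_zero_iff.1 h1.symm

theorem IsFormalExp.exponent_unique [LambdaComplete V] {E F T : Module.End ℂ⟦X⟧ V}
    (hE : EqUpTo 1 E 0) (hF : EqUpTo 1 F 0) (h : IsFormalExp E T) (h' : IsFormalExp F T) :
    E = F := by
  ext v
  exact (h.intertwine hE hF h' LinearMap.id (fun _ => rfl) v).symm

theorem IsFormalExp.eqUpTo {E F S T : Module.End ℂ⟦X⟧ V}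
    (hE : EqUpTo 1 E 0) (hF : EqUpTo 1 F 0) (hS : IsFormalExp E S) (hT : IsFormalExp F T)
    {n : ℕ} (h : EqUpTo n F E) (v : V) : EqUpTo (n + 1) (T v - S v) (F v - E v) :=
  hS.eqUpTo_sub hE hF hT LinearMap.id (fun v => h.linearMap_apply v) v

theorem isFormalExp_zero : IsFormalExp (0 : Module.End ℂ⟦X⟧ V) LinearMap.id := by
  rw [isFormalExp_iff (EqUpTo.refl _ _)]
  intro n v
  cases n with
  | zero => exact EqUpTo.zero _ _
  | succ n => simpa [expSum_apply, Finset.sum_range_succ'] using EqUpTo.refl (n + 1) v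

theorem IsFormalExp.apply_of_apply_eq_zero [LambdaComplete V] {E T : Module.End ℂ⟦X⟧ V}
    (hE : EqUpTo 1 E 0) (hT : IsFormalExp E T) {v : V} (hv : E v = 0) : T v = v := by
  refine LambdaComplete.eq_of_eqUpTo fun n => ?_
  refine (((isFormalExp_iff hE).1 hT (n + 1) v).mono n.le_succ).trans ?_
  simpa [expSum_apply, Finset.sum_range_succ', pow_succ, hv] using EqUpTo.refl n v

theorem IsFormalExp.eqUpTo_id {E T : Module.End ℂ⟦X⟧ V} (hE : EqUpTo 1 E 0)
    (hT : IsFormalExp E T) {n : ℕ} (h : EqUpTo n E 0) (v : V) :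
    EqUpTo (n + 1) (T v - v) (E v) := by
  simpa using isFormalExp_zero.eqUpTo (EqUpTo.refl _ _) hE hT h v

/-- The logarithm is a fixed point of `E ↦ T - e^E + E`, a contraction because `e^E - e^F` agrees
with `E - F` to one order beyond that of `E - F`. -/
theorem exists_exponent [LambdaComplete V] {T : Module.End ℂ⟦X⟧ V}
    (hT : EqUpTo 1 T LinearMap.id) : ∃ E, EqUpTo 1 E 0 ∧ IsFormalExp E T := by
  classical
  -- The value `0` outside `O(λ)` is never used: the iteration stays inside.
  let e : Module.End ℂ⟦X⟧ V → Module.End ℂ⟦X⟧ V := fun E =>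
    if h : EqUpTo 1 E 0 then (exists_isFormalExp h).choose else 0
  have he {E} (h : EqUpTo 1 E 0) : IsFormalExp E (e E) := by
    simp only [e, dif_pos h]
    exact (exists_isFormalExp h).choose_spec
  obtain ⟨E, hE, hfix⟩ := LambdaComplete.exists_fixedPoint (fun E => T - e E + E) 0
    (fun E hE => by
      have h1 : EqUpTo 1 (e E) LinearMap.id := LambdaComplete.eqUpTo_linearMap fun v => by
        have := ((he hE).eqUpTo_id hE (EqUpTo.zero _ _) v).trans (hE.linearMap_apply v)
        exact EqUpTo.sub_zero_iff.1 this
      simpa using (hT.sub h1).add hE)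
    (fun n E F hE hF h => LambdaComplete.eqUpTo_linearMap fun v => by
      have h1 := ((he hF).eqUpTo hF hE (he hE) h v)
      have h2 := (EqUpTo.refl (n + 1) (T v - e F v + E v)).sub h1
      simp only [LinearMap.add_apply, LinearMap.sub_apply]
      convert h2 using 1 <;> abel)
  refine ⟨E, hE, ?_⟩
  have : e E = T := by
    have h1 : T - e E + E = E := hfix
    rw [add_eq_right, sub_eq_zero] at h1
    exact h1.symm
  exact this ▸ he hE

/-- The triangular and square truncations of a double series differ by terms with `i + j ≥ n`, all
of them `O(λ^n)`. -/
theorem sum_antidiagonal_eqUpTo {g : ℕ → ℕ → W} (hg : ∀ i j, EqUpTo (i + j) (g i j) 0) (n : ℕ) :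
    EqUpTo n (∑ k ∈ Finset.range n, ∑ ij ∈ Finset.HasAntidiagonal.antidiagonal k, g ij.1 ij.2)
      (∑ i ∈ Finset.range n, ∑ j ∈ Finset.range n, g i j) := by
  simp only [Finset.Nat.sum_antidiagonal_eq_sum_range_succ]
  rw [Finset.sum_range_diag_flip]
  refine EqUpTo.sum fun i _ => (EqUpTo.sum_range (Nat.sub_le n i) fun k hk => ?_).symm
  exact (hg i k).mono (by omega)

theorem pow_leibniz {P : Module.End ℂ⟦X⟧ W} {Q : Module.End ℂ⟦X⟧ U} {R : Module.End ℂ⟦X⟧ V}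
    {β : U →ₗ[ℂ⟦X⟧] V →ₗ[ℂ⟦X⟧] W} (h : ∀ a b, P (β a b) = β (Q a) b + β a (R b))
    (n : ℕ) (a : U) (b : V) :
    (P ^ n) (β a b) = ∑ ij ∈ Finset.HasAntidiagonal.antidiagonal n,
      n.choose ij.1 • β ((Q ^ ij.1) a) ((R ^ ij.2) b) := by
  induction n with
  | zero => simp
  | succ n ih =>
    rw [Finset.sum_antidiagonal_choose_succ_nsmul
      (fun i j => β ((Q ^ i) a) ((R ^ j) b)) n, pow_succ', Module.End.mul_apply, ih]
    simp only [map_sum, map_nsmul, h, smul_add, Finset.sum_add_distrib, pow_succ',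
      Module.End.mul_apply]
    rw [add_comm, add_right_inj]
    refine Finset.sum_congr rfl fun ⟨i, j⟩ hij => ?_
    rw [n.choose_symm_of_eq_add (Finset.HasAntidiagonal.mem_antidiagonal.1 hij).symm]

/-- If `P` is related to `Q` and `R` by the Leibniz rule for a bilinear map, then
`e^P β(a, b) = β(e^Q a, e^R b)`. -/
theorem IsFormalExp.leibniz [LambdaComplete W] {P P' : Module.End ℂ⟦X⟧ W}
    {Q Q' : Module.End ℂ⟦X⟧ U} {R R' : Module.End ℂ⟦X⟧ V} (hP : EqUpTo 1 P 0)
    (hQ : EqUpTo 1 Q 0) (hR : EqUpTo 1 R 0) (hP' : IsFormalExp P P') (hQ' : IsFormalExp Q Q')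
    (hR' : IsFormalExp R R') {β : U →ₗ[ℂ⟦X⟧] V →ₗ[ℂ⟦X⟧] W}
    (h : ∀ a b, P (β a b) = β (Q a) b + β a (R b)) (a : U) (b : V) :
    P' (β a b) = β (Q' a) (R' b) := by
  refine LambdaComplete.eq_of_eqUpTo fun n => ?_
  rw [isFormalExp_iff ‹_›] at hP' hQ' hR'
  have h2 : EqUpTo n (β (Q' a) (R' b)) (β (expSum Q n a) (expSum R n b)) :=
    ((hQ' n a).map (β.flip (R' b))).trans ((hR' n b).map (β (expSum Q n a)))
  refine ((hP' n (β a b)).trans ?_).trans h2.symm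
  have h3 := sum_antidiagonal_eqUpTo (g := fun i j =>
    β (PowerSeries.C ((i.factorial : ℂ)⁻¹) • (Q ^ i) a)
      (PowerSeries.C ((j.factorial : ℂ)⁻¹) • (R ^ j) b)) (fun i j => by
      obtain ⟨x, hx⟩ := EqUpTo.zero_iff.1 (expTerm_eqUpTo hQ i a)
      obtain ⟨y, hy⟩ := EqUpTo.zero_iff.1 (expTerm_eqUpTo hR j b)
      rw [hx, hy]
      exact EqUpTo.zero_iff.2 ⟨β x y, by simp [smul_smul, pow_add, mul_comm]⟩) n
  convert h3 using 1
  · rw [expSum_apply]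
    refine Finset.sum_congr rfl fun k _ => ?_
    rw [pow_leibniz h, Finset.smul_sum]
    refine Finset.sum_congr rfl fun ij hij => ?_
    obtain rfl := Finset.HasAntidiagonal.mem_antidiagonal.1 hij
    rw [map_smul, LinearMap.map_smul₂, smul_smul, ← Nat.cast_smul_eq_nsmul ℂ⟦X⟧, smul_smul]
    congr 1
    rw [← map_natCast (PowerSeries.C (R := ℂ)), ← map_mul, ← map_mul]
    congr 1
    have h4 : (((ij.1 + ij.2).choose ij.1 : ℕ) : ℂ) * ij.1.factorial * ij.2.factorial =
        (ij.1 + ij.2).factorial := by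
      rw [Nat.choose_symm_add]
      exact_mod_cast Nat.add_choose_mul_factorial_mul_factorial ij.1 ij.2
    rw [← h4]
    have h5 : (((ij.1 + ij.2).choose ij.1 : ℕ) : ℂ) ≠ 0 := by
      exact_mod_cast (Nat.choose_pos (Nat.le_add_right _ _)).ne'
    have h6 (k : ℕ) : (k.factorial : ℂ) ≠ 0 := by exact_mod_cast k.factorial_ne_zero
    have := h6 ij.1
    have := h6 ij.2
    field_simp
  · simp only [expSum_apply, map_sum, LinearMap.sum_apply]
    exact Finset.sum_comm

end FormalExp

section Algebra

variable {B : Type*} [Ring B] [Algebra ℂ⟦X⟧ B]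

theorem EqUpTo.mul {n : ℕ} {x y x' y' : B} (h : EqUpTo n x y) (h' : EqUpTo n x' y') :
    EqUpTo n (x * x') (y * y') :=
  (h.map (LinearMap.mulRight ℂ⟦X⟧ x')).trans (h'.map (LinearMap.mulLeft ℂ⟦X⟧ y))

theorem EqUpTo.mulLeft {n : ℕ} {x y : B} (h : EqUpTo n x y) :
    EqUpTo n (LinearMap.mulLeft ℂ⟦X⟧ x) (LinearMap.mulLeft ℂ⟦X⟧ y) :=
  h.map (LinearMap.mul ℂ⟦X⟧ B)

theorem EqUpTo.mulRight {n : ℕ} {x y : B} (h : EqUpTo n x y) :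
    EqUpTo n (LinearMap.mulRight ℂ⟦X⟧ x) (LinearMap.mulRight ℂ⟦X⟧ y) :=
  h.map (LinearMap.mul ℂ⟦X⟧ B).flip

end Algebra

/-! ### The deformed algebra: coefficients, commutators and inner automorphisms. -/

namespace FormalDeformation

variable {A : Type*} [CommRing A] [Algebra ℂ A] (S : FormalDeformation A)

theorem _root_.PowerSeries.coeff_X_pow_smul_map (f : A⟦X⟧) (n k : ℕ) :
    PowerSeries.coeff k (ϖ ^ n • f) = if n ≤ k then PowerSeries.coeff (k - n) f else 0 := by
  have h : ϖ ^ n • f = (PowerSeries.X : A⟦X⟧) ^ n * f := by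
    rw [Algebra.smul_def, PowerSeries.algebraMap_apply'']
    simp
  rw [h, PowerSeries.coeff_X_pow_mul']

/-- The coefficient of `λ^k`. -/
def coeff (k : ℕ) : S.Alg →+ A := (PowerSeries.coeff (R := A) k).toAddMonoidHom

theorem coeff_X_pow_smul (f : S.Alg) (n k : ℕ) :
    S.coeff k (ϖ ^ n • f) = if n ≤ k then S.coeff (k - n) f else 0 :=
  PowerSeries.coeff_X_pow_smul_map f n k

variable {S} in
theorem ext_coeff {x y : S.Alg} (h : ∀ k, S.coeff k x = S.coeff k y) : x = y :=
  PowerSeries.ext h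

theorem exists_coeff_eq (c : ℕ → A) : ∃ x : S.Alg, ∀ k, S.coeff k x = c k :=
  ⟨PowerSeries.mk c, fun k => PowerSeries.coeff_mk k c⟩

theorem eqUpTo_iff_coeff {n : ℕ} {x y : S.Alg} :
    EqUpTo n x y ↔ ∀ k < n, S.coeff k x = S.coeff k y := by
  constructor
  · rintro ⟨z, rfl⟩ k hk
    rw [map_add, coeff_X_pow_smul, if_neg hk.not_ge, add_zero]
  · intro h
    obtain ⟨z, hz⟩ := S.exists_coeff_eq fun k => S.coeff (k + n) x - S.coeff (k + n) y
    refine ⟨z, ext_coeff fun k => ?_⟩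
    rw [map_add, coeff_X_pow_smul]
    split_ifs with hk
    · rw [hz, Nat.sub_add_cancel hk, add_sub_cancel]
    · rw [h k (not_le.1 hk), add_zero]

instance : LambdaComplete S.Alg where
  torsion_free x h := ext_coeff fun n => by
    have h1 := S.coeff_X_pow_smul x 1 (n + 1)
    rw [pow_one, h] at h1
    simpa using h1.symm
  hausdorff x h := ext_coeff fun n => S.eqUpTo_iff_coeff.1 (h (n + 1)) n n.lt_succ_self
  complete x h := by
    have hx {n m : ℕ} (hnm : n ≤ m) : EqUpTo n (x m) (x n) := by
      induction m, hnm using Nat.le_induction with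
      | base => exact EqUpTo.refl _ _
      | succ m hm ih => exact ((h m).mono hm).trans ih
    obtain ⟨l, hl⟩ := S.exists_coeff_eq fun k => S.coeff k (x (k + 1))
    refine ⟨l, fun n => S.eqUpTo_iff_coeff.2 fun k hk => ?_⟩
    rw [hl]
    exact (S.eqUpTo_iff_coeff.1 (hx (Nat.succ_le_of_lt hk)) k k.lt_succ_self).symm

theorem eqUpTo_one_const (a : S.Alg) : EqUpTo 1 a (S.const (S.coeff 0 a)) := by
  rw [eqUpTo_iff_coeff]
  intro k hk
  obtain rfl : k = 0 := by omega
  exact (PowerSeries.coeff_zero_C (R := A) (S.coeff 0 a)).symm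

theorem coeff_const_mul_const (a b : A) (k : ℕ) :
    S.coeff k (S.const a * S.const b) = S.cochain k a b := by
  have h : (S.const a * S.const b : S.Alg) = PowerSeries.mk fun r => S.cochain r a b :=
    S.star_C a b
  rw [h]
  exact PowerSeries.coeff_mk k fun r => S.cochain r a b

/-- `C_0` is commutative, so every commutator gains a factor `λ`. This is the source of `ad(H) ∈ λ
Der` and of `Ad(1 + O(λ)) = id + O(λ²)`. -/
theorem mul_comm_eqUpTo_one (a b : S.Alg) : EqUpTo 1 (a * b) (b * a) := by
  have ha := S.eqUpTo_one_const a
  have hb := S.eqUpTo_one_const b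
  refine ((ha.mul hb).trans ?_).trans (hb.mul ha).symm
  rw [eqUpTo_iff_coeff]
  intro k hk
  obtain rfl : k = 0 := by omega
  rw [coeff_const_mul_const, coeff_const_mul_const, cochain_zero, cochain_zero, mul_comm]

theorem mul_comm_eqUpTo {n : ℕ} {a : S.Alg} (ha : EqUpTo n a 0) (b : S.Alg) :
    EqUpTo (n + 1) (a * b) (b * a) := by
  obtain ⟨c, rfl⟩ := EqUpTo.zero_iff.1 ha
  obtain ⟨z, hz⟩ := S.mul_comm_eqUpTo_one c b
  exact ⟨z, by rw [smul_mul_assoc, hz, mul_smul_comm, smul_add, smul_smul, pow_one, pow_succ]⟩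

theorem ad_apply (H a : S.Alg) : S.ad H a = H * a - a * H := rfl

theorem ad_mem_Der (H : S.Alg) : S.ad H ∈ S.Der := fun a b => by
  simp only [ad_apply, sub_mul, mul_sub, mul_assoc]
  abel

theorem ad_eqUpTo {n : ℕ} {H : S.Alg} (h : EqUpTo n H 0) : EqUpTo (n + 1) (S.ad H) 0 :=
  LambdaComplete.eqUpTo_linearMap fun a => EqUpTo.sub_zero_iff.2 (S.mul_comm_eqUpTo h a)

/-- Cancelling `λ` in the Leibniz rule shows that the quotient of a derivation by `λ` is again a
derivation. -/
theorem mem_lambdaDer {D : Module.End ℂ⟦X⟧ S.Alg} :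
    D ∈ S.lambdaDer ↔ D ∈ S.Der ∧ EqUpTo 1 D 0 := by
  constructor
  · rintro ⟨D, hD, rfl⟩
    exact ⟨S.Der.smul_mem _ hD, EqUpTo.one_zero_iff.2 ⟨D, rfl⟩⟩
  · rintro ⟨hD, h⟩
    obtain ⟨D, rfl⟩ := EqUpTo.one_zero_iff.1 h
    refine ⟨D, fun a b => LambdaComplete.X_smul_cancel ?_, rfl⟩
    simpa [smul_add] using hD a b

theorem innDer_le_lambdaDer : S.InnDer ≤ S.lambdaDer := by
  rintro _ ⟨H, rfl⟩
  exact S.mem_lambdaDer.2 ⟨S.ad_mem_Der H, S.ad_eqUpTo (EqUpTo.zero H 0)⟩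

theorem Ad_apply (u : S.Algˣ) (a : S.Alg) :
    S.Ad u a = u * a * ((u⁻¹ : S.Algˣ) : S.Alg) := rfl

theorem mem_selfEquiv {n : ℕ} {T : S.Aut} :
    T ∈ S.selfEquiv n ↔ ∀ a, EqUpTo n (T a) a :=
  ⟨fun h a => EqUpTo.linearMap_apply h a, fun h => LambdaComplete.eqUpTo_linearMap h⟩

theorem innerOne_le : S.innerOne ≤ S.selfEquiv 2 := by
  rintro _ ⟨u, hu, rfl⟩
  rw [mem_selfEquiv]
  intro a
  have h1 : EqUpTo 2 ((u - 1 : S.Alg) * a) (a * (u - 1)) :=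
    S.mul_comm_eqUpTo (EqUpTo.sub_zero_iff.2 hu) a
  have h2 : EqUpTo 2 ((u : S.Alg) * a) (a * u) := by
    simpa [sub_mul, mul_sub] using h1.add (EqUpTo.refl 2 a)
  simpa [Ad_apply, mul_assoc] using h2.mul (EqUpTo.refl 2 ((u⁻¹ : S.Algˣ) : S.Alg))

theorem conj_Ad (T : S.Aut) (u : S.Algˣ) :
    T * S.Ad u * T⁻¹ = S.Ad (Units.map (T : S.Alg →* S.Alg) u) := by
  ext a
  simp [Ad_apply]

theorem innerOne_normal : (S.innerOne.subgroupOf (S.selfEquiv 2)).Normal := by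
  constructor
  rintro ⟨_, _⟩ ⟨u, hu, rfl⟩ T
  refine ⟨_, ?_, (S.conj_Ad T u).symm⟩
  have := EqUpTo.map hu (T : S.Aut).toLinearMap
  exact this.trans (by simpa using EqUpTo.refl 1 (1 : S.Alg))

/-! ### Exponentials of derivations -/

variable {S}

theorem exp_derivation_mul {D T : Module.End ℂ⟦X⟧ S.Alg} (hD : D ∈ S.Der) (hD₁ : EqUpTo 1 D 0)
    (hT : IsFormalExp D T) (a b : S.Alg) : T (a * b) = T a * T b :=
  hT.leibniz hD₁ hD₁ hD₁ hT hT (β := LinearMap.mul ℂ⟦X⟧ S.Alg) hD a b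

theorem derivation_one {D : Module.End ℂ⟦X⟧ S.Alg} (hD : D ∈ S.Der) : D 1 = 0 := by
  simpa using hD 1 1

theorem exp_eqUpTo_id {n : ℕ} {E T : Module.End ℂ⟦X⟧ S.Alg} (hE : EqUpTo 1 E 0)
    (hT : IsFormalExp E T) (h : EqUpTo n E 0) (a : S.Alg) : EqUpTo n (T a) a :=
  EqUpTo.sub_zero_iff.1 (((hT.eqUpTo_id hE h a).mono n.le_succ).trans (h.linearMap_apply a))

theorem exists_selfEquiv_of_derivation {D : Module.End ℂ⟦X⟧ S.Alg} (hD : D ∈ S.Der)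
    (hD₂ : EqUpTo 2 D 0) : ∃ T ∈ S.selfEquiv 2, IsFormalExp D T.toLinearMap := by
  have hD₁ : EqUpTo 1 D 0 := hD₂.mono one_le_two
  obtain ⟨T, hT⟩ := exists_isFormalExp hD₁
  have hbij : Function.Bijective T := LambdaComplete.bijective_of_eqUpTo_one
    (LambdaComplete.eqUpTo_linearMap fun a => exp_eqUpTo_id hD₁ hT hD₁ a)
  have hmul := exp_derivation_mul hD hD₁ hT
  have hone : T 1 = 1 := by
    obtain ⟨a, ha⟩ := hbij.2 1
    have := hmul 1 a
    rwa [one_mul, ha, mul_one, eq_comm] at this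
  refine ⟨AlgEquiv.ofBijective (AlgHom.ofLinearMap T hone hmul) hbij,
    mem_selfEquiv S |>.2 fun a => exp_eqUpTo_id hD₁ hT hD₂ a, hT⟩

theorem exists_derivation_of_selfEquiv {T : S.Aut} (hT : T ∈ S.selfEquiv 2) :
    ∃ D ∈ S.Der, EqUpTo 2 D 0 ∧ IsFormalExp D T.toLinearMap := by
  obtain ⟨E, hE, hET⟩ := exists_exponent (EqUpTo.mono hT one_le_two)
  refine ⟨E, ?_, LambdaComplete.eqUpTo_linearMap fun a => ?_, hET⟩
  · let F : Module.End ℂ⟦X⟧ (Module.End ℂ⟦X⟧ S.Alg) :=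
      LinearMap.mulLeft ℂ⟦X⟧ E - LinearMap.mulRight ℂ⟦X⟧ E
    have hF : EqUpTo 1 F 0 := by
      simpa using hE.mulLeft.sub hE.mulRight
    obtain ⟨C, hC⟩ := exists_isFormalExp hF
    have h1 (φ : Module.End ℂ⟦X⟧ S.Alg) (v : S.Alg) : T (φ v) = C φ (T v) :=
      hET.leibniz hE hF hE hC hET (β := LinearMap.id) (by simp [F]) φ v
    have h2 := hET.intertwine hE hF hC (LinearMap.mul ℂ⟦X⟧ S.Alg) (fun v => by
      ext w
      have := h1 (LinearMap.mul ℂ⟦X⟧ S.Alg v) (T.symm w)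
      simpa using this.symm)
    intro a b
    have h3 := LinearMap.congr_fun (h2 a) b
    have h4 : E (a * b) - a * E b = E a * b := h3
    rw [← h4]
    abel
  · have h1 := hET.eqUpTo_id hE hE a
    exact h1.symm.trans (EqUpTo.sub_zero_iff.2 (EqUpTo.linearMap_apply hT a))

/-- `e^{D + ad(K)} = Ad(u) e^D` for `u = e^{D + K}(1)`. -/
theorem exp_add_ad {D : Module.End ℂ⟦X⟧ S.Alg} (hD : D ∈ S.Der) (hD₁ : EqUpTo 1 D 0)
    {K : S.Alg} (hK : EqUpTo 1 K 0) {T T' L : Module.End ℂ⟦X⟧ S.Alg} (hT : IsFormalExp D T)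
    (hT' : IsFormalExp (D + S.ad K) T')
    (hL : IsFormalExp (D + LinearMap.mulLeft ℂ⟦X⟧ K) L) :
    ∃ u : S.Algˣ, (u : S.Alg) = L 1 ∧ ∀ a, T' a = S.Ad u (T a) := by
  have hDL : EqUpTo 1 (D + LinearMap.mulLeft ℂ⟦X⟧ K) 0 := by
    simpa using hD₁.add hK.mulLeft
  have hDR : EqUpTo 1 (D - LinearMap.mulRight ℂ⟦X⟧ K) 0 := by
    simpa using hD₁.sub hK.mulRight
  have hDA : EqUpTo 1 (D + S.ad K) 0 := by
    simpa using hD₁.add ((S.ad_eqUpTo hK).mono one_le_two)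
  obtain ⟨R, hR⟩ := exists_isFormalExp hDR
  -- `D + ad K` obeys a mixed Leibniz rule: `D + L_K` acts on the left factor and `D - R_K` on the
  -- right one.
  have h1 (a b : S.Alg) : T' (a * b) = L a * R b :=
    hT'.leibniz hDA hDL hDR hL hR (β := LinearMap.mul ℂ⟦X⟧ S.Alg) (fun a b => by
      simp only [LinearMap.mul_apply', LinearMap.add_apply, LinearMap.sub_apply, hD a b,
        LinearMap.mulLeft_apply, LinearMap.mulRight_apply, ad_apply, add_mul, mul_sub, mul_assoc]
      abel) a b
  have h2 (a b : S.Alg) : L (a * b) = L a * T b :=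
    hL.leibniz hDL hDL hD₁ hL hT (β := LinearMap.mul ℂ⟦X⟧ S.Alg) (fun a b => by
      simp only [LinearMap.mul_apply', LinearMap.add_apply, hD a b,
        LinearMap.mulLeft_apply, add_mul, mul_assoc]
      abel) a b
  have h3 (a : S.Alg) : T' a = L 1 * T a * R 1 := by
    rw [← h2, ← h1, one_mul, mul_one]
  have hDA' : D + S.ad K ∈ S.Der := S.Der.add_mem hD (S.ad_mem_Der K)
  have hT1 : T 1 = 1 := hT.apply_of_apply_eq_zero hD₁ (derivation_one hD)
  have hT'1 : T' 1 = 1 := hT'.apply_of_apply_eq_zero hDA (derivation_one hDA')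
  -- Hence `R 1` is the inverse of `u = L 1`, and `h3` becomes conjugation by `u`.
  have h4 : L 1 * R 1 = 1 := by rw [← h1, one_mul, hT'1]
  obtain ⟨v, hv⟩ := LambdaComplete.isUnit_of_eqUpTo_one (exp_eqUpTo_id hDL hL hDL 1)
  refine ⟨v, hv, fun a => ?_⟩
  rw [h3, Ad_apply, hv]
  congr 1
  rw [← hv] at h4
  exact (Units.inv_eq_of_mul_eq_one_right h4).symm

/-- A logarithm twisted by `D`. Changing `K` changes `e^{D + L_K}(1)` by the same amount to leading
order, so `K ↦ u - e^{D + L_K}(1) + K` is a contraction. -/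
theorem exists_exp_add_mulLeft_one {D : Module.End ℂ⟦X⟧ S.Alg}
    (hD₁ : EqUpTo 1 D 0) {u : S.Alg} (hu : EqUpTo 1 u 1) :
    ∃ K L, EqUpTo 1 K 0 ∧ IsFormalExp (D + LinearMap.mulLeft ℂ⟦X⟧ K) L ∧ L 1 = u := by
  classical
  have hDL {K : S.Alg} (hK : EqUpTo 1 K 0) : EqUpTo 1 (D + LinearMap.mulLeft ℂ⟦X⟧ K) 0 := by
    simpa using hD₁.add hK.mulLeft
  let e : S.Alg → Module.End ℂ⟦X⟧ S.Alg := fun K =>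
    if h : EqUpTo 1 K 0 then (exists_isFormalExp (hDL h)).choose else 0
  have he {K} (h : EqUpTo 1 K 0) : IsFormalExp (D + LinearMap.mulLeft ℂ⟦X⟧ K) (e K) := by
    simp only [e, dif_pos h]
    exact (exists_isFormalExp (hDL h)).choose_spec
  obtain ⟨K, hK, hfix⟩ := LambdaComplete.exists_fixedPoint (fun K => u - e K 1 + K) 0
    (fun K hK => by
      have h1 := exp_eqUpTo_id (hDL hK) (he hK) (hDL hK) 1
      simpa using (hu.sub h1).add hK)
    (fun n K K' hK hK' h => by
      have h1 := (he hK').eqUpTo (hDL hK') (hDL hK) (he hK)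
        ((EqUpTo.refl n D).add h.mulLeft) 1
      have h2 := (EqUpTo.refl (n + 1) (u - e K' 1 + K)).sub h1
      convert h2 using 1
      · abel
      · simp; abel)
  refine ⟨K, e K, hK, he hK, ?_⟩
  have h1 : u - e K 1 + K = K := hfix
  rw [add_eq_right, sub_eq_zero] at h1
  exact h1.symm

end FormalDeformation

/-! ### Automorphisms modulo inner ones, condition C0 and the logarithm. -/

namespace FormalDeformation

variable {A : Type*} [CommRing A] [Algebra ℂ A] {S : FormalDeformation A}

/-- `e^E = Ad(u) e^D` for some `u = 1 + O(λ)` if and only if `E - D` is `ad` of some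
`K = O(λ)`. -/
theorem exists_Ad_mul_exp_iff {D E : Module.End ℂ⟦X⟧ S.Alg} (hD : D ∈ S.Der)
    (hD₁ : EqUpTo 1 D 0) (hE₁ : EqUpTo 1 E 0) {T T' : S.Aut}
    (hT : IsFormalExp D T.toLinearMap) (hT' : IsFormalExp E T'.toLinearMap) :
    (∃ u ∈ S.unitsOne, T' = S.Ad u * T) ↔ ∃ K, EqUpTo 1 K 0 ∧ E = D + S.ad K := by
  have hDL {K : S.Alg} (hK : EqUpTo 1 K 0) : EqUpTo 1 (D + LinearMap.mulLeft ℂ⟦X⟧ K) 0 := by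
    simpa using hD₁.add hK.mulLeft
  have hDA {K : S.Alg} (hK : EqUpTo 1 K 0) : EqUpTo 1 (D + S.ad K) 0 := by
    simpa using hD₁.add ((S.ad_eqUpTo hK).mono one_le_two)
  constructor
  · rintro ⟨u, hu, rfl⟩
    obtain ⟨K, L, hK, hL, hLu⟩ := exists_exp_add_mulLeft_one hD₁ hu
    obtain ⟨R, hR⟩ := exists_isFormalExp (hDA hK)
    obtain ⟨v, hv, hvR⟩ := exp_add_ad hD hD₁ hK hT hR hL
    obtain rfl : v = u := Units.ext (hv.trans hLu)
    refine ⟨K, hK, hT'.exponent_unique hE₁ (hDA hK) ?_⟩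
    have : R = (S.Ad v * T).toLinearMap := LinearMap.ext hvR
    exact this ▸ hR
  · rintro ⟨K, hK, rfl⟩
    obtain ⟨L, hL⟩ := exists_isFormalExp (hDL hK)
    obtain ⟨v, hv, hvT⟩ := exp_add_ad hD hD₁ hK hT hT' hL
    refine ⟨v, ?_, AlgEquiv.ext hvT⟩
    have h1 := exp_eqUpTo_id (hDL hK) hL (hDL hK) 1
    rw [← hv] at h1
    exact h1

theorem exists_ad_isFormalExp_Ad {u : S.Algˣ} (hu : EqUpTo 1 (u : S.Alg) 1) :
    ∃ H, EqUpTo 1 H 0 ∧ IsFormalExp (S.ad H) (S.Ad u).toLinearMap := by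
  have h0 : EqUpTo 1 (0 : Module.End ℂ⟦X⟧ S.Alg) 0 := EqUpTo.refl _ _
  obtain ⟨E, hE, hET⟩ := exists_exponent
    (EqUpTo.mono (S.innerOne_le ⟨u, hu, rfl⟩) one_le_two)
  obtain ⟨H, hH, rfl⟩ := (exists_Ad_mul_exp_iff (T := 1) (S.Der.zero_mem) h0 hE
    isFormalExp_zero hET).1 ⟨u, hu, (mul_one _).symm⟩
  exact ⟨H, hH, by simpa using hET⟩

/-- The `O(λ)` tail of `u` has commutators `O(λ²)`, so the `λ`-coefficient of `[u, g]` is `C_1(u₀,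
g) - C_1(g, u₀)`. -/
theorem coeff_zero_mem_poissonCenter {u : S.Alg} (hu : ∀ a, EqUpTo 2 (u * a) (a * u)) :
    S.coeff 0 u ∈ S.poissonCenter := by
  intro g
  obtain ⟨z, hz⟩ := S.eqUpTo_one_const u
  have h0 : EqUpTo 1 (ϖ ^ 1 • z) 0 := EqUpTo.zero_iff.2 ⟨z, rfl⟩
  have h1 := (hu (S.const g)).sub (S.mul_comm_eqUpTo h0 (S.const g))
  have h2 : u - ϖ ^ 1 • z = S.const (S.coeff 0 u) :=
    sub_eq_iff_eq_add.2 hz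
  rw [← sub_mul, ← mul_sub, h2] at h1
  have h3 := S.eqUpTo_iff_coeff.1 h1 1 one_lt_two
  rw [coeff_const_mul_const, coeff_const_mul_const] at h3
  rw [poissonBracket, h3, sub_self, smul_zero]

theorem Ad_eq_one {u : S.Algˣ} (hu : (u : S.Alg) ∈ Subalgebra.center ℂ⟦X⟧ S.Alg) :
    S.Ad u = 1 := by
  ext a
  rw [Subalgebra.mem_center_iff] at hu
  simp [Ad_apply, ← hu a, mul_assoc]

theorem exists_unitsOne_of_conditionC0 (hC0 : S.ConditionC0) {u : S.Algˣ}
    (hu : S.Ad u ∈ S.selfEquiv 2) : ∃ u' ∈ S.unitsOne, S.Ad u = S.Ad u' := by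
  obtain ⟨ρ, hρ⟩ := hC0
  have hcomm (a : S.Alg) : EqUpTo 2 ((u : S.Alg) * a) (a * u) := by
    have := (S.mem_selfEquiv.1 hu a).mul (EqUpTo.refl 2 (u : S.Alg))
    simpa [Ad_apply, mul_assoc] using this
  obtain ⟨hc, hc₁⟩ := hρ ⟨_, coeff_zero_mem_poissonCenter hcomm⟩
  generalize ρ ⟨_, coeff_zero_mem_poissonCenter hcomm⟩ = c at hc hc₁
  have hcu : EqUpTo 1 c u := hc₁.trans (S.eqUpTo_one_const u).symm
  -- The central lift `c` of `u₀` is invertible since `u⁻¹ ⋆ c = 1 + O(λ)`; the new unit is `u ⋆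
  -- c⁻¹`.
  have h1 := (EqUpTo.refl 1 ((u⁻¹ : S.Algˣ) : S.Alg)).mul hcu
  rw [Units.inv_mul] at h1
  obtain ⟨w, hw⟩ := LambdaComplete.isUnit_of_eqUpTo_one h1
  have hcw : ((u * w : S.Algˣ) : S.Alg) = c := by
    rw [Units.val_mul, hw, Units.mul_inv_cancel_left]
  refine ⟨u * (u * w)⁻¹, ?_, ?_⟩
  · have h2 := hcu.symm.mul (EqUpTo.refl 1 (((u * w)⁻¹ : S.Algˣ) : S.Alg))
    rw [← hcw, Units.mul_inv] at h2
    exact h2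
  · rw [map_mul, map_inv, Ad_eq_one (u := u * w) (hcw ▸ hc), inv_one, mul_one]

theorem existsUnique_lambdaDer (T : S.selfEquiv 2) :
    ∃! D : S.lambdaDer, IsFormalExp (ϖ • (D : Module.End ℂ⟦X⟧ S.Alg))
      (T : S.Aut).toLinearMap := by
  obtain ⟨E, hE, hE₂, hET⟩ := exists_derivation_of_selfEquiv T.2
  obtain ⟨D, rfl⟩ := EqUpTo.one_zero_iff.1 (hE₂.mono one_le_two)
  have hD₁ : EqUpTo 1 D 0 := LambdaComplete.eqUpTo_of_X_smul (by simpa using hE₂)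
  have hD : D ∈ S.Der := fun a b => LambdaComplete.X_smul_cancel (by
    simpa [smul_add] using hE a b)
  refine ⟨⟨D, S.mem_lambdaDer.2 ⟨hD, hD₁⟩⟩, hET, fun D' hD' => Subtype.ext ?_⟩
  exact LambdaComplete.X_smul_cancel (hD'.exponent_unique (EqUpTo.one_zero_iff.2 ⟨_, rfl⟩)
    (EqUpTo.one_zero_iff.2 ⟨_, rfl⟩) hET)

theorem X_smul_lambdaDer (D : S.lambdaDer) :
    ϖ • (D : Module.End ℂ⟦X⟧ S.Alg) ∈ S.Der ∧
      EqUpTo 2 (ϖ • (D : Module.End ℂ⟦X⟧ S.Alg)) 0 := by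
  obtain ⟨hD, hD₁⟩ := S.mem_lambdaDer.1 D.2
  exact ⟨S.Der.smul_mem _ hD, by simpa using hD₁.X_smul⟩

variable (S) in
/-- The bijection `e^{λD} ↦ D`. -/
def logEquiv : S.selfEquiv 2 ≃ S.lambdaDer :=
  Equiv.ofBijective (fun T => (existsUnique_lambdaDer T).choose) <| by
    have hspec (T : S.selfEquiv 2) := (existsUnique_lambdaDer T).choose_spec
    constructor
    · intro T T' h
      have h1 := (hspec T).1
      have h2 := (hspec T').1
      simp only at h h1 h2
      rw [← h] at h2
      refine Subtype.ext (AlgEquiv.toLinearMap_injective (h1.unique ?_ h2))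
      exact EqUpTo.one_zero_iff.2 ⟨_, rfl⟩
    · intro D
      obtain ⟨hD, hD₂⟩ := X_smul_lambdaDer D
      obtain ⟨T, hT, hDT⟩ := exists_selfEquiv_of_derivation hD hD₂
      exact ⟨⟨T, hT⟩, ((hspec ⟨T, hT⟩).2 D hDT).symm⟩

theorem isFormalExp_logEquiv (T : S.selfEquiv 2) :
    IsFormalExp (ϖ • (S.logEquiv T : Module.End ℂ⟦X⟧ S.Alg)) (T : S.Aut).toLinearMap :=
  (existsUnique_lambdaDer T).choose_spec.1

theorem logEquiv_eq {T : S.selfEquiv 2} {D : S.lambdaDer}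
    (h : IsFormalExp (ϖ • (D : Module.End ℂ⟦X⟧ S.Alg)) (T : S.Aut).toLinearMap) :
    S.logEquiv T = D :=
  (existsUnique_lambdaDer T).unique (isFormalExp_logEquiv T) h

/-- Cosets correspond although the logarithm need not respect products: `T' = Ad(u) T` means that
the exponents differ by `ad(λH)`, and one factor `λ` cancels. Normality turns `T⁻¹ T'` into `T'
T⁻¹`. -/
theorem inv_mul_mem_innerOne_iff (T T' : S.selfEquiv 2) :
    T⁻¹ * T' ∈ S.innerOne.subgroupOf (S.selfEquiv 2) ↔
      -S.logEquiv T + S.logEquiv T' ∈ S.InnDer.submoduleOf S.lambdaDer := by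
  obtain ⟨hD, hD₂⟩ := X_smul_lambdaDer (S.logEquiv T)
  obtain ⟨-, hD₂'⟩ := X_smul_lambdaDer (S.logEquiv T')
  have h := exists_Ad_mul_exp_iff hD (hD₂.mono one_le_two) (hD₂'.mono one_le_two)
    (isFormalExp_logEquiv T) (isFormalExp_logEquiv T')
  rw [S.innerOne_normal.mem_comm_iff]
  have hl : T' * T⁻¹ ∈ S.innerOne.subgroupOf (S.selfEquiv 2) ↔
      ∃ u ∈ S.unitsOne, (T' : S.Aut) = S.Ad u * T :=
    exists_congr fun u => and_congr_right fun _ => eq_comm.trans mul_inv_eq_iff_eq_mul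
  rw [hl, h]
  constructor
  · rintro ⟨K, hK, hE⟩
    obtain ⟨H, rfl⟩ := EqUpTo.one_zero_iff.1 hK
    refine ⟨H, LambdaComplete.X_smul_cancel ?_⟩
    rw [map_smul, ← sub_eq_iff_eq_add'] at hE
    rw [← hE]
    simp [sub_eq_neg_add]
  · rintro ⟨H, hH⟩
    refine ⟨ϖ • H, EqUpTo.one_zero_iff.2 ⟨H, rfl⟩, ?_⟩
    rw [map_smul, hH]
    simp

end FormalDeformation

end

theorem mainTheorem10
    {E : Type*} [NormedAddCommGroup E] [NormedSpace ℝ E] [FiniteDimensional ℝ E]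
    {M : Type*} [TopologicalSpace M] [T2Space M] [SecondCountableTopology M]
    [ChartedSpace E M] [IsManifold 𝓘(ℝ, E) ∞ M]
    (S : StarProduct E M) (hC0 : S.ConditionC0) :
    (∀ u : S.Algˣ, EqUpTo 2 (S.Ad u).toLinearMap LinearMap.id →
      ∃ u' : S.Algˣ, EqUpTo 1 (u' : S.Alg) 1 ∧ S.Ad u = S.Ad u' ∧
        ∃ H : S.Alg, EqUpTo 1 H 0 ∧ IsFormalExp (S.ad H) (S.Ad u).toLinearMap) ∧
    S.innerOne ≤ S.selfEquiv 2 ∧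
    (S.innerOne.subgroupOf (S.selfEquiv 2)).Normal ∧
    S.InnDer ≤ S.lambdaDer ∧
    (∀ T : S.selfEquiv 2, ∃! D : S.lambdaDer,
      IsFormalExp ((PowerSeries.X : ℂ⟦X⟧) • (D : Module.End ℂ⟦X⟧ S.Alg))
        (T : S.Aut).toLinearMap) ∧
    ∃ Φ : (S.selfEquiv 2 ⧸ S.innerOne.subgroupOf (S.selfEquiv 2)) ≃
        (S.lambdaDer ⧸ S.InnDer.submoduleOf S.lambdaDer),
      ∀ (T : S.selfEquiv 2) (D : S.lambdaDer),
        IsFormalExp ((PowerSeries.X : ℂ⟦X⟧) • (D : Module.End ℂ⟦X⟧ S.Alg))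
          (T : S.Aut).toLinearMap →
        Φ (QuotientGroup.mk T) = Submodule.Quotient.mk D := by
  refine ⟨fun u hu => ?_, S.innerOne_le, S.innerOne_normal, S.innDer_le_lambdaDer,
    FormalDeformation.existsUnique_lambdaDer, ?_⟩
  · obtain ⟨u', hu', h⟩ := FormalDeformation.exists_unitsOne_of_conditionC0 hC0 hu
    refine ⟨u', hu', h, ?_⟩
    rw [h]
    exact FormalDeformation.exists_ad_isFormalExp_Ad hu'
  · refine ⟨Quotient.congr S.logEquiv fun T T' => ?_, fun T D h => ?_⟩
    · exact QuotientGroup.leftRel_apply.trans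
        ((FormalDeformation.inv_mul_mem_innerOne_iff T T').trans
          (QuotientAddGroup.leftRel_apply
            (s := (S.InnDer.submoduleOf S.lambdaDer).toAddSubgroup)).symm)
    · rw [← FormalDeformation.logEquiv_eq h]
      rfl
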